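/- **Setting.** Let $\mathcal V$ be a finite vocabulary, and consider a causal decoder-only Transformer language model with context bound $K$, embedding dimension $d\ge 4$, $L$ blocks, at least one attention head per block and attention dimension at least $1$. On a prompt $\mathrm s\in\mathcal V^{\le K}$ (a nonempty sequence of at most $K$ tokens) it starts from $\mathbf H^{(0)}(\mathrm s)$, the sum of learned token and positional embeddings, and applies $L$ pre-LayerNorm residual blocks $$\mathbf Y=\mathbf H^{(k-1)}+\mathrm{attn}\big(\mathrm{LN}(\mathbf H^{(k-1)})\big),\qquad \mathbf H^{(k)}=\mathbf Y+\mathrm{mlp}\big(\mathrm{LN}'(\mathbf Y)\big),$$ where $\mathrm{attn}$ is multi-head causal softmax self-attention, the MLP activation is real-analytic on $\mathbb R$, and the LayerNorm constant is positive. The next-token distribution is $\mathrm{softmax}(\mathbf U\,\mathrm{LN}(\mathbf r))$, where $\mathbf r$ is the last row of $\mathbf H^{(L)}(\mathrm s)$. Let $\boldsymbol\theta\in\mathbb R^p$ collect all parameters. The parameters are drawn as $\boldsymbol\theta_0\sim\mu$, with $\mu$ a probability measure absolutely continuous with respect to Lebesgue measure on $\mathbb R^p$. They are then trained by a fixed finite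 number $N\ge 0$ of (mini-batch) gradient steps $\boldsymbol\theta_{k+1}=\boldsymbol\theta_k-\eta_k\nabla\mathcal L_{\mathcal B_k}(\boldsymbol\theta_k)$ with fixed step sizes $\eta_k\in(0,1)$. Here $\mathcal L_{\mathcal B}$ is the average cross-entropy loss over a nonempty batch $\mathcal B$ of samples (prompt, target distribution on $\mathcal V$) from a fixed finite data set; the batches may be chosen arbitrarily, also at random or adversarially. Fix $\ell\in\{1,\dots,L\}$. For the trained parameters $\boldsymbol\theta_N$ let $\mathbf h_t(\mathrm s)$ be the $t$-th row of $\mathbf H^{(\ell)}(\mathrm s)$. For $\pi\in\mathcal V^{t-1}$ and $v\in\mathcal V$ put $F(v;\pi,t)=\mathbf h_t(\pi\oplus v)$, where $\oplus$ appends a token, and $$\Delta_{\pi,t}=\min_{v\ne v'}\|F(v;\pi,t)-F(v';\pi,t)\|_2$$ (with $\Delta_{\pi,t}=\infty$ if $|\mathcal V|=1$). **Algorithm (SipIt).** The input consists of observed states $\widehat{\mathbf h}_1,\dots,\widehat{\mathbf h}_T\in\mathbb R^d$ and a tolerance $\varepsilon\ge0$. Start with the empty sequence $\widehat{\mathrm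 s}$. For $t=1,\dots,T$, for at most $|\mathcal V|$ iterations, a policy proposes a token $v$ not yet tried at this position, and one verifier test checks whether $\|\widehat{\mathbf h}_t-F(v;\widehat{\mathrm s},|\widehat{\mathrm s}|+1)\|_2\le\varepsilon$. If so, $v$ is accepted and appended to $\widehat{\mathrm s}$, and the search at position $t$ ends; otherwise $v$ is marked as tried. Return $\widehat{\mathrm s}$. The policy is any rule, possibly randomized, that proposes untried tokens only, so that it enumerates $\mathcal V$ without replacement. **Theorem.** 1. For all parameters, all observations of length $T\le K$, all tolerances and all policies, SipIt halts after at most $|\mathcal V|$ verifier tests at each position, hence at most $T|\mathcal V|$ verifier tests in total. 2. With probability one over the draw of $\boldsymbol\theta_0$, the following holds for every choice of the batches and every prompt $\mathrm s=\langle\mathrm s_1,\dots,\mathrm s_T\rangle\in\mathcal V^{\le K}$, with $\pi_t=\langle \mathrm s_1,\dots,\mathrm s_{t-1}\rangle$. All the margins $\Delta_{\pi_t,t}$, $t=1,\dots,T$, are positive. Moreover, suppose that $\varepsilon\ge 0$, that $\widehat{\mathbf h}_t=\mathbf h_t(\mathrm s)+\mathbf e_t$ with $\|\mathbf e_t\|_2\le\varepsilon$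 for all $t$, and that either $\varepsilon<\tfrac12\Delta_{\pi_t,t}$ for all $t$ or $\varepsilon=0$ (the noiseless case). Then, with every policy and every realization of its randomness, SipIt with tolerance $\varepsilon$ accepts the true token $\mathrm s_t$ at every position $t$ within $|\mathcal V|$ tests, outputs exactly $\mathrm s$, and uses at most $T|\mathcal V|$ verifier tests in total. -/

import Mathlib

/-! ## Architecture and parameters of a causal decoder-only Transformer language model -/

/-- The hyper-parameters of the model: context bound `ctx`, embedding dimension `dim`, number of
blocks `depth`; for each block the number of attention heads, the attention dimension of a head, and
the list of hidden widths of the MLP (an MLP with hidden widths `[w₁, …, wₖ]` has `k + 1` affine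
layers); the activation function and the positive constant used in layer normalization. -/
structure Arch where
  ctx : ℕ
  dim : ℕ
  depth : ℕ
  heads : Fin depth → ℕ
  headDim : Fin depth → ℕ
  hidden : Fin depth → List ℕ
  act : ℝ → ℝ
  lnEps : ℝ

/-- Names of the scalar parameters of an MLP `ℝᵃ → ℝᵇ` with the given hidden widths: for each affine
layer a weight matrix (`Sum.inl (row, column)`) and a bias vector (`Sum.inr row`). -/
def MLPParam : ℕ → List ℕ → ℕ → Type
  | a, [], b => (Fin b × Fin a) ⊕ Fin b
  | a, w :: ws, b => ((Fin w × Fin a) ⊕ Fin w) ⊕ MLPParam w ws b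

instance MLPParam.instFintype : (a : ℕ) → (ws : List ℕ) → (b : ℕ) → Fintype (MLPParam a ws b)
  | a, [], b => inferInstanceAs (Fintype ((Fin b × Fin a) ⊕ Fin b))
  | a, w :: ws, b =>
    haveI := MLPParam.instFintype w ws b
    inferInstanceAs (Fintype (((Fin w × Fin a) ⊕ Fin w) ⊕ MLPParam w ws b))

instance MLPParam.instDecidableEq :
    (a : ℕ) → (ws : List ℕ) → (b : ℕ) → DecidableEq (MLPParam a ws b)
  | a, [], b => inferInstanceAs (DecidableEq ((Fin b × Fin a) ⊕ Fin b))
  | a, w :: ws, b =>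
    haveI := MLPParam.instDecidableEq w ws b
    inferInstanceAs (DecidableEq (((Fin w × Fin a) ⊕ Fin w) ⊕ MLPParam w ws b))

/-- Names of the scalar parameters of one Transformer block on `ℝᵈ` with `H` heads of attention
dimension `e` and MLP hidden widths `ws`. -/
inductive BlockParam (d H e : ℕ) (ws : List ℕ) : Type
  | attnScale (i : Fin d)
  | attnShift (i : Fin d)
  | query (h : Fin H) (i : Fin d) (j : Fin e)
  | key (h : Fin H) (i : Fin d) (j : Fin e)
  | value (h : Fin H) (i : Fin d) (j : Fin e)
  | out (h : Fin H) (j : Fin e) (i : Fin d)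
  | mlpScale (i : Fin d)
  | mlpShift (i : Fin d)
  | mlp (k : MLPParam d ws d)
  deriving Fintype, DecidableEq

/-- Names of all scalar parameters of the language model: token embeddings, positional embeddings,
the parameters of each block, the final layer normalization and the unembedding matrix. -/
inductive ParamIdx (V : Type*) (A : Arch)
  | tok (v : V) (i : Fin A.dim)
  | pos (k : Fin A.ctx) (i : Fin A.dim)
  | block (l : Fin A.depth) (k : BlockParam A.dim (A.heads l) (A.headDim l) (A.hidden l))
  | finalScale (i : Fin A.dim)
  | finalShift (i : Fin A.dim)
  | unemb (v : V) (i : Fin A.dim)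
  deriving Fintype, DecidableEq

/-- The parameter space `ℝᵖ`, with its Euclidean structure and Lebesgue measure. -/
abbrev Params (V : Type*) (A : Arch) : Type _ := EuclideanSpace ℝ (ParamIdx V A)

/-- Prompts: nonempty token sequences of length at most `K`. -/
abbrev Prompt (V : Type*) (K : ℕ) : Type _ := {s : List V // s ≠ [] ∧ s.length ≤ K}

/-! ## The components of the model -/

noncomputable section

/-- Layer normalization of a vector, with constant `ε`, scale `γ` and shift `β`. -/
def layerNorm {d : ℕ} (ε : ℝ) (γ β x : Fin d → ℝ) : Fin d → ℝ :=
  let m : ℝ := (∑ i, x i) / d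
  let var : ℝ := (∑ i, (x i - m) ^ 2) / d
  fun i => γ i * ((x i - m) / Real.sqrt (var + ε)) + β i

/-- The MLP: affine maps, with the activation `σ` applied entrywise between consecutive ones. -/
def mlpMap (σ : ℝ → ℝ) : (a : ℕ) → (ws : List ℕ) → (b : ℕ) →
    (MLPParam a ws b → ℝ) → (Fin a → ℝ) → (Fin b → ℝ)
  | _, [], _, p, x => fun i => (∑ j, p (Sum.inl (i, j)) * x j) + p (Sum.inr i)
  | _, w :: ws, b, p, x =>
    mlpMap σ w ws b (fun k => p (Sum.inr k))
      (fun i => σ ((∑ j, p (Sum.inl (Sum.inl (i, j))) * x j) + p (Sum.inl (Sum.inr i))))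

/-- Causal self-attention with query, key and value matrices `Q`, `K`, `W`: the entrywise exponential
of the scaled scores is restricted to `j ≤ i`, its rows are normalized to sum `1`, and the result
multiplies `X W`. This is the row-wise softmax of the scores with `-∞` added above the diagonal. -/
def causalAttention {T d e : ℕ} (Q K W : Matrix (Fin d) (Fin e) ℝ) (X : Matrix (Fin T) (Fin d) ℝ) :
    Matrix (Fin T) (Fin e) ℝ :=
  let S : Matrix (Fin T) (Fin T) ℝ := Matrix.of fun i j =>
    if j ≤ i then Real.exp (((X * Q) * (X * K).transpose) i j / Real.sqrt e) else 0
  (Matrix.of fun i j => S i j / ∑ k, S i k) * (X * W)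

/-- Multi-head causal self-attention: the heads are concatenated and multiplied by the output
matrix, whose rows are indexed by pairs (head, coordinate). -/
def multiHead {T d H e : ℕ} {ws : List ℕ} (p : BlockParam d H e ws → ℝ)
    (X : Matrix (Fin T) (Fin d) ℝ) : Matrix (Fin T) (Fin d) ℝ :=
  (Matrix.of fun (t : Fin T) (hj : Fin H × Fin e) =>
    causalAttention (Matrix.of fun i j => p (.query hj.1 i j)) (Matrix.of fun i j => p (.key hj.1 i j))
      (Matrix.of fun i j => p (.value hj.1 i j)) X t hj.2) *
  (Matrix.of fun (hj : Fin H × Fin e) (i : Fin d) => p (.out hj.1 hj.2 i))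

/-- A pre-layer-norm Transformer block: `H = X + attn(LN X)`, `TB(X) = H + mlp(LN H)`, with layer
normalization and the MLP applied row-wise. -/
def transformerBlock (σ : ℝ → ℝ) (ε : ℝ) {T d H e : ℕ} {ws : List ℕ} (p : BlockParam d H e ws → ℝ)
    (X : Matrix (Fin T) (Fin d) ℝ) : Matrix (Fin T) (Fin d) ℝ :=
  let Y : Matrix (Fin T) (Fin d) ℝ := X + multiHead p (Matrix.of fun t =>
    layerNorm ε (fun i => p (.attnScale i)) (fun i => p (.attnShift i)) (X t))
  Y + Matrix.of fun t => mlpMap σ d ws d (fun k => p (.mlp k))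
    (layerNorm ε (fun i => p (.mlpScale i)) (fun i => p (.mlpShift i)) (Y t))

/-- Softmax of a vector of scores. -/
def softmaxFn {V : Type*} [Fintype V] (z : V → ℝ) : V → ℝ :=
  fun v => Real.exp (z v) / ∑ w, Real.exp (z w)

section Model

variable {V : Type*} {A : Arch}

/-- Token plus positional embedding of a token sequence. (The model has positional embeddings for
`A.ctx` positions only; sequences longer than `A.ctx` never occur in what follows, and the value `0`
is a placeholder for them.) -/
def embedding (θ : Params V A) (s : List V) : Matrix (Fin s.length) (Fin A.dim) ℝ :=
  Matrix.of fun t i => θ (.tok (s.get t) i) +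
    if h : (t : ℕ) < A.ctx then θ (.pos ⟨t, h⟩ i) else 0

/-- The matrix `H⁽ˡ⁾(s)` of hidden states after the first `l` blocks; `H⁽⁰⁾` is the embedding. -/
def hiddenStates (θ : Params V A) (s : List V) :
    (l : ℕ) → l ≤ A.depth → Matrix (Fin s.length) (Fin A.dim) ℝ
  | 0, _ => embedding θ s
  | l + 1, h => transformerBlock A.act A.lnEps (fun k => θ (.block ⟨l, h⟩ k))
      (hiddenStates θ s l (Nat.le_of_succ_le h))

/-- The layer-`l` hidden state `h_t(s)` at position `t`, as a Euclidean vector. -/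
def hiddenState (θ : Params V A) (l : ℕ) (hl : l ≤ A.depth) (s : List V) (t : Fin s.length) :
    EuclideanSpace ℝ (Fin A.dim) :=
  WithLp.toLp 2 (hiddenStates θ s l hl t)

/-- The last-token representation of a prompt, after all blocks. -/
def lastRepr (θ : Params V A) (s : Prompt V A.ctx) : EuclideanSpace ℝ (Fin A.dim) :=
  hiddenState θ A.depth le_rfl s.1
    ⟨s.1.length - 1, Nat.sub_lt (List.length_pos_of_ne_nil s.2.1) Nat.one_pos⟩

/-! ## Next-token prediction, loss, and training by (mini-batch) gradient descent -/

/-- Next-token distribution: softmax of the unembedded, layer-normalized last-token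
representation. -/
def nextToken [Fintype V] (θ : Params V A) (s : Prompt V A.ctx) : V → ℝ :=
  softmaxFn fun v => ∑ i, θ (.unemb v i) *
    layerNorm A.lnEps (fun i => θ (.finalScale i)) (fun i => θ (.finalShift i)) (lastRepr θ s) i

/-- Cross-entropy loss of a sample: a prompt and a target distribution on the vocabulary. -/
def sampleLoss [Fintype V] (x : Prompt V A.ctx × stdSimplex ℝ V) (θ : Params V A) : ℝ :=
  -∑ v, (x.2 : V → ℝ) v * Real.log (nextToken θ x.1 v)

/-- Average loss over a mini-batch, a multiset of indices of training samples. -/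
def batchLoss [Fintype V] {n : ℕ} (data : Fin n → Prompt V A.ctx × stdSimplex ℝ V)
    (B : Multiset (Fin n)) (θ : Params V A) : ℝ :=
  (B.map fun i => sampleLoss (data i) θ).sum / (Multiset.card B : ℝ)

/-- The parameters after `N` gradient steps with step sizes `η` and batches `B`, started at `θ₀`. -/
def trained [Fintype V] {n : ℕ} (data : Fin n → Prompt V A.ctx × stdSimplex ℝ V) (η : ℕ → ℝ)
    (B : ℕ → Multiset (Fin n)) (θ₀ : Params V A) : ℕ → Params V A
  | 0 => θ₀
  | N + 1 => trained data η B θ₀ N -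
      η N • gradient (batchLoss data (B N)) (trained data η B θ₀ N)

/-! ## One-step maps, margins, verifier, policies, and the algorithm -/

/-- The one-step map `F(v; π, t) = h_t(π ⊕ v)`, where `t` is the position following the prefix
`π`. -/
def oneStep (θ : Params V A) (l : ℕ) (hl : l ≤ A.depth) (π : List V) (v : V) :
    EuclideanSpace ℝ (Fin A.dim) :=
  hiddenState θ l hl (π ++ [v]) ⟨π.length, by simp⟩

/-- The margin: the minimal distance between values of the one-step map at distinct tokens. It is
`∞` for a one-token vocabulary (minimum over no pair at all). -/
def margin (θ : Params V A) (l : ℕ) (hl : l ≤ A.depth) (π : List V) : ENNReal :=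
  ⨅ (v : V) (v' : V) (_ : v ≠ v'), edist (oneStep θ l hl π v) (oneStep θ l hl π v')

/-- The acceptance region of a token: a closed ball around its one-step value. -/
def acceptRegion (θ : Params V A) (l : ℕ) (hl : l ≤ A.depth) (ε : ℝ) (π : List V) (v : V) :
    Set (EuclideanSpace ℝ (Fin A.dim)) :=
  Metric.closedBall (oneStep θ l hl π v) ε

/-- A policy: at each position (counted from `0`), given the prefix recovered so far and the set
`C` of tokens already tried, it proposes a token not in `C`, unless `C` is the whole vocabulary, in
which case its value is irrelevant. This is one realization of a possibly randomized policy: at every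
call the pair (position, `C`) is new, so any run of a randomized, stateful or data-dependent policy is
a run of a policy in this sense. -/
structure Policy (V : Type*) where
  next : ℕ → List V → Finset V → V
  next_notMem : ∀ (t : ℕ) (π : List V) (C : Finset V), (∃ v, v ∉ C) → next t π C ∉ C

open scoped Classical in
/-- The inner loop: `fuel` is the number of remaining iterations and `C` the set of tokens tried so
far. Returns the accepted token, if any, and the number of verifier tests performed. -/
def innerLoop (next : Finset V → V) (accept : V → Prop) : (fuel : ℕ) → (C : Finset V) → Option V × ℕ
  | 0, _ => (none, 0)
  | k + 1, C =>
    if accept (next C) then (some (next C), 1)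
    else
      let r := innerLoop next accept k (insert (next C) C)
      (r.1, r.2 + 1)

/-- The search for a token at one position `t` with recovered prefix `π` and observed state `y`: at
most `|V|` iterations, started with no token tried. -/
def searchAt [Fintype V] (θ : Params V A) (l : ℕ) (hl : l ≤ A.depth) (ε : ℝ) (P : Policy V)
    (t : ℕ) (π : List V) (y : EuclideanSpace ℝ (Fin A.dim)) : Option V × ℕ :=
  innerLoop (P.next t π) (fun v => y ∈ acceptRegion θ l hl ε π v) (Fintype.card V) ∅

/-- The sequence recovered by SipIt after the first `t` positions: an accepted token is appended,
and nothing is appended at a position where no token was accepted. -/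
def sipItPrefix [Fintype V] (θ : Params V A) (l : ℕ) (hl : l ≤ A.depth) (ε : ℝ) (P : Policy V)
    {T : ℕ} (obs : Fin T → EuclideanSpace ℝ (Fin A.dim)) : (t : ℕ) → t ≤ T → List V
  | 0, _ => []
  | t + 1, h =>
    let π := sipItPrefix θ l hl ε P obs t (Nat.le_of_succ_le h)
    π ++ (searchAt θ l hl ε P t π (obs ⟨t, h⟩)).1.toList

/-- The outcome of the inner loop of SipIt at position `t`: accepted token and number of verifier
tests. -/
def sipItStep [Fintype V] (θ : Params V A) (l : ℕ) (hl : l ≤ A.depth) (ε : ℝ) (P : Policy V)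
    {T : ℕ} (obs : Fin T → EuclideanSpace ℝ (Fin A.dim)) (t : Fin T) : Option V × ℕ :=
  searchAt θ l hl ε P t (sipItPrefix θ l hl ε P obs t t.2.le) (obs t)

/-- The output of SipIt on the observed states `obs`. -/
def sipItOutput [Fintype V] (θ : Params V A) (l : ℕ) (hl : l ≤ A.depth) (ε : ℝ) (P : Policy V)
    {T : ℕ} (obs : Fin T → EuclideanSpace ℝ (Fin A.dim)) : List V :=
  sipItPrefix θ l hl ε P obs T le_rfl

/-- The total number of verifier tests in a run of SipIt. -/
def sipItTests [Fintype V] (θ : Params V A) (l : ℕ) (hl : l ≤ A.depth) (ε : ℝ) (P : Policy V)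
    {T : ℕ} (obs : Fin T → EuclideanSpace ℝ (Fin A.dim)) : ℕ :=
  ∑ t, (sipItStep θ l hl ε P obs t).2

end Model

end

/-! By causality the observed state at position `t` is the one-step map of the true prefix at the
true token. So if the one-step maps of all prefixes are injective, the margins are positive, the
true token is the only accepted one, and induction on `t` recovers the prompt.

Injectivity is generic. Hidden states are real-analytic in the parameters, and a difference of two
one-step values is not identically zero: with all blocks zero the hidden state is the embedding.
Zero sets of nontrivial analytic functions are null (`ContDiff.ae_ne_zero`).

Training keeps this generic if a gradient step pulls null sets back to null sets. Its Jacobian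
determinant is analytic, so by `ContDiff.quasiMeasurePreserving` one point where it is nonzero
suffices. The origin is such a point: the logits vanish there to second order, which makes the
Hessian form of the loss at most `‖ξ‖²`, so `1 - η • Hessian` is injective for `0 < η < 1`
(`det_fderiv_gradientStep_ne_zero`, `exists_tendsto_sampleLoss_smul`). There are countably many
batch sequences of length `N`, so one null set serves them all. -/

open scoped ContDiff

/-! ### The search loop: test counts, and correctness when acceptance is unique. -/

section Search

variable {V : Type*}

theorem innerLoop_tests_le (next : Finset V → V) (accept : V → Prop) (k : ℕ) (C : Finset V) :
    (innerLoop next accept k C).2 ≤ k := by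
  induction k generalizing C with
  | zero => simp [innerLoop]
  | succ k ih =>
    unfold innerLoop
    split_ifs
    · simp
    · exact Nat.succ_le_succ (ih _)

/-- Invariant: the sought token is untried, and remaining fuel plus tried tokens cover the
vocabulary. Fuel cannot run out first, since a set missing `v₀` has fewer than `|V|` elements. -/
theorem innerLoop_eq_some [Fintype V] {next : Finset V → V}
    (hnext : ∀ C : Finset V, (∃ v, v ∉ C) → next C ∉ C) {accept : V → Prop} {v₀ : V}
    (hacc : ∀ v, accept v ↔ v = v₀) (k : ℕ) (C : Finset V) (hC : v₀ ∉ C)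
    (hk : Fintype.card V ≤ k + C.card) : (innerLoop next accept k C).1 = some v₀ := by
  classical
  induction k generalizing C with
  | zero =>
    have := Finset.card_lt_univ_of_notMem hC
    omega
  | succ k ih =>
    unfold innerLoop
    split_ifs with h
    · simpa using (hacc _).1 h
    · have hne : next C ≠ v₀ := fun h' => h ((hacc _).2 h')
      have hn := hnext C ⟨v₀, hC⟩
      have hcard := Finset.card_insert_of_notMem hn
      convert ih (insert (next C) C) (by simp [hC, hne.symm]) (by omega) using 4

variable [Fintype V] {A : Arch} (θ : Params V A) (l : ℕ) (hl : l ≤ A.depth) (ε : ℝ) (P : Policy V)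

theorem sipItStep_tests_le {T : ℕ} (obs : Fin T → EuclideanSpace ℝ (Fin A.dim)) (t : Fin T) :
    (sipItStep θ l hl ε P obs t).2 ≤ Fintype.card V :=
  innerLoop_tests_le _ _ _ _

theorem sipItTests_le {T : ℕ} (obs : Fin T → EuclideanSpace ℝ (Fin A.dim)) :
    sipItTests θ l hl ε P obs ≤ T * Fintype.card V := by
  simpa [sipItTests] using
    Finset.sum_le_card_nsmul Finset.univ _ _ fun t _ => sipItStep_tests_le θ l hl ε P obs t

variable {θ l hl ε P}

theorem sipIt_correct {s : List V} {obs : Fin s.length → EuclideanSpace ℝ (Fin A.dim)}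
    (hobs : ∀ (t : Fin s.length) (v : V),
      obs t ∈ acceptRegion θ l hl ε (s.take t) v ↔ v = s.get t) :
    (∀ t, (sipItStep θ l hl ε P obs t).1 = some (s.get t)) ∧ sipItOutput θ l hl ε P obs = s := by
  have key : ∀ t : Fin s.length,
      (searchAt θ l hl ε P t (s.take t) (obs t)).1 = some (s.get t) := fun t =>
    innerLoop_eq_some (P.next_notMem t (s.take t)) (hobs t) _ _ (by simp) (by simp)
  -- `key` concerns searches run on the true prefix; this induction shows that no others occur.
  have hpre : ∀ t (ht : t ≤ s.length), sipItPrefix θ l hl ε P obs t ht = s.take t := by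
    intro t
    induction t with
    | zero => intro _; simp [sipItPrefix]
    | succ t ih =>
      intro ht
      have := key ⟨t, ht⟩
      simp only [sipItPrefix, ih] at this ⊢
      rw [this]
      simp
  refine ⟨fun t => ?_, ?_⟩
  · rw [sipItStep, hpre]
    exact key t
  · rw [sipItOutput, hpre, List.take_length]

end Search

/-! ### Causality: hidden states do not depend on later tokens. -/

section Causality

theorem Fin.sum_castLE_of_eq_zero {M : Type*} [AddCommMonoid M] {m n : ℕ} (h : m ≤ n)
    (f : Fin n → M) (hf : ∀ k : Fin n, m ≤ k → f k = 0) :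
    ∑ k, f k = ∑ k : Fin m, f (Fin.castLE h k) := by
  obtain ⟨r, rfl⟩ := Nat.exists_eq_add_of_le h
  rw [Fin.sum_univ_add, Finset.sum_eq_zero (s := Finset.univ) (f := fun i => f (Fin.natAdd m i)),
    add_zero]
  · rfl
  · intro i _
    exact hf _ (by simp)

/-- The mask kills every term of index at least `T'`, in the normalizing sum as well as in the
weighted average. -/
theorem causalAttention_castLE {T T' d e : ℕ} (h : T' ≤ T) (Q K W : Matrix (Fin d) (Fin e) ℝ)
    {X : Matrix (Fin T) (Fin d) ℝ} {X' : Matrix (Fin T') (Fin d) ℝ}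
    (hX : ∀ t, X (Fin.castLE h t) = X' t) (t : Fin T') :
    causalAttention Q K W X (Fin.castLE h t) = causalAttention Q K W X' t := by
  have hle : ∀ a b : Fin T', Fin.castLE h a ≤ Fin.castLE h b ↔ a ≤ b := fun a b => Iff.rfl
  have hnot : ∀ k : Fin T, T' ≤ k → ¬ k ≤ Fin.castLE h t := by
    intro k hk hkt
    have h1 : (k : ℕ) ≤ t := hkt
    have := t.2
    omega
  funext j
  simp only [causalAttention, Matrix.mul_apply, Matrix.of_apply, Matrix.transpose_apply]
  rw [Fin.sum_castLE_of_eq_zero h _ (fun k hk => by rw [if_neg (hnot k hk)]; simp)]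
  refine Finset.sum_congr rfl fun k _ => ?_
  rw [Fin.sum_castLE_of_eq_zero h _ (fun k hk => by rw [if_neg (hnot k hk)])]
  simp only [hX, hle]

theorem transformerBlock_castLE (σ : ℝ → ℝ) (ε : ℝ) {T T' d H e : ℕ} {ws : List ℕ}
    (p : BlockParam d H e ws → ℝ) (h : T' ≤ T)
    {X : Matrix (Fin T) (Fin d) ℝ} {X' : Matrix (Fin T') (Fin d) ℝ}
    (hX : ∀ t, X (Fin.castLE h t) = X' t) (t : Fin T') :
    transformerBlock σ ε p X (Fin.castLE h t) = transformerBlock σ ε p X' t := by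
  have hattn : ∀ (Z : Matrix (Fin T) (Fin d) ℝ) (Z' : Matrix (Fin T') (Fin d) ℝ),
      (∀ t, Z (Fin.castLE h t) = Z' t) → multiHead p Z (Fin.castLE h t) = multiHead p Z' t := by
    intro Z Z' hZ
    funext i
    simp only [multiHead, Matrix.mul_apply, Matrix.of_apply, causalAttention_castLE h _ _ _ hZ t]
  have hY := hattn (Matrix.of fun t =>
    layerNorm ε (fun i => p (.attnScale i)) (fun i => p (.attnShift i)) (X t))
    (Matrix.of fun t =>
    layerNorm ε (fun i => p (.attnScale i)) (fun i => p (.attnShift i)) (X' t))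
    (fun t => by funext i; simp only [Matrix.of_apply, hX])
  have hrow : ∀ (M N : Matrix (Fin T) (Fin d) ℝ) (a : Fin T), (M + N) a = M a + N a :=
    fun _ _ _ => rfl
  have hrow' : ∀ (M N : Matrix (Fin T') (Fin d) ℝ) (a : Fin T'), (M + N) a = M a + N a :=
    fun _ _ _ => rfl
  funext i
  simp only [transformerBlock, hrow, hrow', hX, hY, Matrix.of_apply, Pi.add_apply]

variable {V : Type*} {A : Arch}

theorem hiddenStates_append (θ : Params V A) (s u : List V) (l : ℕ) (hl : l ≤ A.depth)
    (t : Fin s.length) :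
    hiddenStates θ (s ++ u) l hl (Fin.castLE (by simp) t) = hiddenStates θ s l hl t := by
  induction l generalizing t with
  | zero =>
    funext i
    simp [hiddenStates, embedding]
  | succ l ih => exact transformerBlock_castLE _ _ _ _ (ih _) t

theorem hiddenState_eq_oneStep (θ : Params V A) (l : ℕ) (hl : l ≤ A.depth) (s : List V)
    (t : Fin s.length) :
    hiddenState θ l hl s t = oneStep θ l hl (s.take t) (s.get t) := by
  have hs : s = (s.take t ++ [s.get t]) ++ s.drop (t + 1) := by simp
  -- The index type depends on the list, so the list is varied together with its index before
  -- rewriting.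
  have key : ∀ (s' : List V) (_ : s' = s) (a : Fin s'.length), (a : ℕ) = t →
      hiddenState θ l hl s t = hiddenState θ l hl s' a := by
    rintro s' rfl a ha
    rw [Fin.ext ha]
  have hlen : (s.take t).length = t := by simp
  rw [key _ hs.symm (Fin.castLE (by simp) (⟨(s.take t).length, by simp⟩ :
    Fin (s.take t ++ [s.get t]).length)) hlen]
  simp only [hiddenState, oneStep, hiddenStates_append]

end Causality

/-! ### Positive margins and uniqueness of the accepted token. -/

section Margin

variable {V : Type*} {A : Arch} {θ : Params V A} {l : ℕ} {hl : l ≤ A.depth}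

/-- The infimum runs over finitely many pairs; on the diagonal it is over an empty family, hence
`⊤`. -/
theorem margin_pos [Fintype V] {π : List V}
    (h : ∀ v v', v ≠ v' → oneStep θ l hl π v ≠ oneStep θ l hl π v') :
    0 < margin θ l hl π := by
  classical
  simp only [margin]
  rw [← Finset.inf_univ_eq_iInf, Finset.lt_inf_iff (by simp)]
  intro v _
  rw [← Finset.inf_univ_eq_iInf, Finset.lt_inf_iff (by simp)]
  intro v' _
  by_cases hv : v = v'
  · simp [hv]
  · simpa [hv] using h v v' hv

theorem margin_le {π : List V} {v v' : V} (hv : v ≠ v') :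
    margin θ l hl π ≤ edist (oneStep θ l hl π v) (oneStep θ l hl π v') :=
  iInf_le_of_le v (iInf_le_of_le v' (iInf_le _ hv))

/-- If a wrong token were accepted, the triangle inequality would bound the margin by `2ε`. -/
theorem mem_acceptRegion_iff {π : List V} {v₀ : V} {ε : ℝ} {e : EuclideanSpace ℝ (Fin A.dim)}
    (hpos : 0 < margin θ l hl π) (hε : 0 ≤ ε) (he : ‖e‖ ≤ ε)
    (h : ε = 0 ∨ ENNReal.ofReal ε < margin θ l hl π / 2) (v : V) :
    oneStep θ l hl π v₀ + e ∈ acceptRegion θ l hl ε π v ↔ v = v₀ := by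
  constructor
  · intro hmem
    by_contra hv
    have hdist : dist (oneStep θ l hl π v) (oneStep θ l hl π v₀) ≤ ε + ε := by
      rw [acceptRegion, Metric.mem_closedBall, dist_comm] at hmem
      refine (dist_triangle _ _ _).trans (add_le_add hmem ?_)
      simpa using he
    have hm := margin_le (θ := θ) (hl := hl) (π := π) hv
    have hle : margin θ l hl π ≤ ENNReal.ofReal ε + ENNReal.ofReal ε := by
      rw [← ENNReal.ofReal_add hε hε]
      refine hm.trans ?_
      rw [edist_dist]
      exact ENNReal.ofReal_le_ofReal hdist
    rcases h with rfl | h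
    · simp at hle
      exact hpos.ne' hle
    · rw [ENNReal.lt_div_iff_mul_lt (by simp) (by simp), mul_two] at h
      exact absurd h hle.not_gt
  · rintro rfl
    simpa [acceptRegion] using he

end Margin

/-! ### Analytic maps and null sets. -/

section AnalyticNull

open MeasureTheory Measure Filter Topology

variable {E : Type*} [NormedAddCommGroup E] [NormedSpace ℝ E] [FiniteDimensional ℝ E]

/-- In a basis, the Leibniz formula makes the determinant a polynomial in the matrix entries. -/
theorem ContDiff.clm_det {F : Type*} [NormedAddCommGroup F] [NormedSpace ℝ F] {n : WithTop ℕ∞}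
    {f : F → E →L[ℝ] E} (hf : ContDiff ℝ n f) : ContDiff ℝ n fun x => (f x).det := by
  let b := Module.finBasis ℝ E
  have h : ∀ x, (f x).det = ∑ σ : Equiv.Perm (Fin (Module.finrank ℝ E)),
      (Equiv.Perm.sign σ : ℝ) * ∏ i, b.equivFunL (f x (b i)) (σ i) := by
    intro x
    rw [ContinuousLinearMap.det, ← LinearMap.det_toMatrix b, Matrix.det_apply']
    simp [LinearMap.toMatrix_apply]
  simp only [h]
  refine ContDiff.sum fun σ _ => contDiff_const.mul (contDiff_prod fun i _ => ?_)
  exact contDiff_pi.1 (b.equivFunL.contDiff.comp (hf.clm_apply contDiff_const)) _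

variable [MeasurableSpace E] [BorelSpace E] (μ : Measure E) [μ.IsAddHaarMeasure]

theorem ContDiff.ae_ne_zero_real {f : ℝ → ℝ} (hf : ContDiff ℝ ω f) {a : ℝ} (ha : f a ≠ 0) :
    ∀ᵐ t : ℝ, f t ≠ 0 := by
  have h : f ⁻¹' {0}ᶜ ∈ codiscreteWithin Set.univ :=
    (contDiff_omega_iff_analyticOnNhd.1 hf).preimage_zero_mem_codiscreteWithin ha (Set.mem_univ a)
      isConnected_univ
  have := ae_restrict_le_codiscreteWithin (μ := (volume : Measure ℝ)) MeasurableSet.univ h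
  rwa [Measure.restrict_univ] at this

/-- The zero set of a real-analytic function that does not vanish identically is a null set. -/
theorem ContDiff.ae_ne_zero {f : E → ℝ} (hf : ContDiff ℝ ω f) {a : E} (ha : f a ≠ 0) :
    ∀ᵐ x ∂μ, f x ≠ 0 := by
  set g : E → ℝ := fun x => f (a + x) with hg
  have hgc : ContDiff ℝ ω g := hf.comp (contDiff_const.add contDiff_id)
  -- Every line through `a` contains `a`, where `f` is nonzero, so the one-variable case applies to
  -- each of them.
  have hline : ∀ x : E, ∀ᵐ t : ℝ, g (t • x) ≠ 0 := fun x =>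
    (hgc.comp (contDiff_id.smul contDiff_const)).ae_ne_zero_real (a := 0) (by simpa [hg] using ha)
  have hmeas : MeasurableSet {p : E × ℝ | g (p.2 • p.1) ≠ 0} :=
    (isOpen_ne.preimage
      (hgc.continuous.comp (continuous_snd.smul continuous_fst))).measurableSet
  -- Fubini exchanges the quantifiers: a single `t ≠ 0` works for almost every `x`, and dilation by
  -- `t` only rescales the measure.
  obtain ⟨t, ht, ht0⟩ : ∃ t : ℝ, (∀ᵐ x ∂μ, g (t • x) ≠ 0) ∧ t ≠ 0 := by
    have h1 : ∀ᵐ t : ℝ, ∀ᵐ x ∂μ, g (t • x) ≠ 0 :=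
      (Measure.ae_ae_comm hmeas).1 (Eventually.of_forall hline)
    have h2 : ∀ᵐ t : ℝ, t ≠ 0 := by simp [ae_iff]
    exact (h1.and h2).exists
  simp only [ae_iff, ne_eq, not_not] at ht
  have hgz : μ {x | g x = 0} = 0 := by
    have := Measure.addHaar_preimage_smul μ ht0 {x | g x = 0}
    rw [show (fun x => t • x) ⁻¹' {x | g x = 0} = {x | g (t • x) = 0} from rfl, ht] at this
    refine (mul_eq_zero.1 this.symm).resolve_left ?_
    simp [ht0]
  rw [ae_iff]
  simp only [ne_eq, not_not]
  rw [← measure_preimage_add μ a]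
  exact hgz

variable {μ}

/-- Near `a` the preimage of `s` is contained in the image of `s` under the local inverse, and
differentiable maps send null sets to null sets. -/
theorem ContDiffAt.exists_nhds_preimage_null {f : E → E} {a : E} (hf : ContDiffAt ℝ 1 f a)
    (hdet : (fderiv ℝ f a).det ≠ 0) {s : Set E} (hs : μ s = 0) :
    ∃ u ∈ 𝓝 a, μ (f ⁻¹' s ∩ u) = 0 := by
  let f' : E ≃L[ℝ] E := (fderiv ℝ f a).toContinuousLinearEquivOfDetNeZero hdet
  have hf' : HasFDerivAt f (f' : E →L[ℝ] E) a := by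
    simpa [f'] using (hf.differentiableAt (by simp)).hasFDerivAt
  let φ := hf.toOpenPartialHomeomorph f hf' (by simp)
  have hsymm : ContDiffAt ℝ 1 φ.symm (f a) := hf.to_localInverse hf' (by simp)
  obtain ⟨w, hw, hwd⟩ : ∃ w ∈ 𝓝 (f a), DifferentiableOn ℝ φ.symm w := by
    obtain ⟨w, hw, hwd⟩ := hsymm.contDiffOn le_rfl (by simp)
    exact ⟨w, by simpa using hw, hwd.differentiableOn (by simp)⟩
  refine ⟨φ.source ∩ f ⁻¹' w, inter_mem ?_ (hf.continuousAt.preimage_mem_nhds hw), ?_⟩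
  · exact φ.open_source.mem_nhds (hf.mem_toOpenPartialHomeomorph_source hf' (by simp))
  · have himg : μ (φ.symm '' (s ∩ w)) = 0 :=
      addHaar_image_eq_zero_of_differentiableOn_of_addHaar_eq_zero μ
        (hwd.mono Set.inter_subset_right) (measure_mono_null Set.inter_subset_left hs)
    refine measure_mono_null ?_ himg
    rintro x ⟨hxs, hxφ, hxw⟩
    exact ⟨f x, ⟨hxs, hxw⟩, φ.left_inv hxφ⟩

/-- A real-analytic self-map whose Jacobian determinant does not vanish identically pulls null sets
back to null sets. -/
theorem ContDiff.quasiMeasurePreserving {f : E → E} (hf : ContDiff ℝ ω f) {a : E}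
    (ha : (fderiv ℝ f a).det ≠ 0) : Measure.QuasiMeasurePreserving f μ μ := by
  refine ⟨hf.continuous.measurable, Measure.AbsolutelyContinuous.mk fun s hsm hs => ?_⟩
  rw [Measure.map_apply hf.continuous.measurable hsm]
  have hdet : ContDiff ℝ ω fun x => (fderiv ℝ f x).det :=
    ContDiff.clm_det (hf.fderiv_right (m := ω) (by simp))
  have hcrit := hdet.ae_ne_zero μ ha
  rw [ae_iff] at hcrit
  -- The critical set is null by analyticity; off it the inverse function theorem gives local
  -- nullity, which is enough.
  have hreg : μ (f ⁻¹' s ∩ {x | (fderiv ℝ f x).det ≠ 0}) = 0 := by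
    refine measure_null_of_locally_null _ fun x hx => ?_
    obtain ⟨u, hu, hu0⟩ := (hf.contDiffAt.of_le (m := 1) (by simp)).exists_nhds_preimage_null
      (μ := μ) hx.2 hs
    refine ⟨f ⁻¹' s ∩ {x | (fderiv ℝ f x).det ≠ 0} ∩ u,
      inter_mem self_mem_nhdsWithin (mem_nhdsWithin_of_mem_nhds hu), measure_mono_null ?_ hu0⟩
    exact Set.inter_subset_inter_left _ Set.inter_subset_left
  refine measure_mono_null ?_ (measure_union_null hreg hcrit)
  intro x hx
  by_cases h : (fderiv ℝ f x).det = 0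
  · exact Or.inr (by simpa using h)
  · exact Or.inl ⟨hx, h⟩

end AnalyticNull

theorem Prompt.nonempty {V : Type*} {K : ℕ} (s : Prompt V K) : Nonempty V :=
  ⟨s.1.head s.2.1⟩

/-! ### Regularity of the model and the loss in the parameters. -/

section ModelAnalytic

variable {E : Type*} [NormedAddCommGroup E] [NormedSpace ℝ E]

/-- Positivity of `ε` keeps the square root away from its singularity. The order `n` stays free: `ω`
gives analyticity, and `0` gives the continuity used in the loss expansion. -/
theorem contDiff_layerNorm {n : WithTop ℕ∞} {d : ℕ} {ε : ℝ} (hε : 0 < ε) {γ β x : E → Fin d → ℝ}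
    (hγ : ∀ i, ContDiff ℝ n fun θ => γ θ i) (hβ : ∀ i, ContDiff ℝ n fun θ => β θ i)
    (hx : ∀ i, ContDiff ℝ n fun θ => x θ i) (i : Fin d) :
    ContDiff ℝ n fun θ => layerNorm ε (γ θ) (β θ) (x θ) i := by
  have hm : ContDiff ℝ n fun θ => (∑ i, x θ i) / (d : ℝ) :=
    (ContDiff.sum fun i _ => hx i).div_const _
  have hv : ContDiff ℝ n fun θ => (∑ j, (x θ j - (∑ i, x θ i) / (d : ℝ)) ^ 2) / (d : ℝ) + ε :=
    ((ContDiff.sum fun j _ => ((hx j).sub hm).pow 2).div_const _).add contDiff_const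
  have hpos : ∀ θ, 0 < (∑ j, (x θ j - (∑ i, x θ i) / (d : ℝ)) ^ 2) / (d : ℝ) + ε :=
    fun θ => by positivity
  exact ((hγ i).mul (((hx i).sub hm).div (hv.sqrt fun θ => (hpos θ).ne')
    fun θ => (Real.sqrt_pos.2 (hpos θ)).ne')).add (hβ i)

theorem contDiff_mlpMap {n : WithTop ℕ∞} {σ : ℝ → ℝ} (hσ : ContDiff ℝ n σ) {a : ℕ}
    (ws : List ℕ) {b : ℕ} {p : E → MLPParam a ws b → ℝ} {x : E → Fin a → ℝ}
    (hp : ∀ k, ContDiff ℝ n fun θ => p θ k) (hx : ∀ i, ContDiff ℝ n fun θ => x θ i) (i : Fin b) :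
    ContDiff ℝ n fun θ => mlpMap σ a ws b (p θ) (x θ) i := by
  induction ws generalizing a with
  | nil => exact (ContDiff.sum fun j _ => (hp _).mul (hx j)).add (hp _)
  | cons w ws ih =>
    exact ih (fun k => hp (Sum.inr k)) fun i =>
      hσ.comp ((ContDiff.sum fun j _ => (hp (Sum.inl (Sum.inl (i, j)))).mul (hx j)).add
        (hp (Sum.inl (Sum.inr i))))

theorem contDiff_matrix_mul {n : WithTop ℕ∞} {l m k : Type*} [Fintype m] {M : E → Matrix l m ℝ}
    {N : E → Matrix m k ℝ} (hM : ∀ i j, ContDiff ℝ n fun θ => M θ i j)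
    (hN : ∀ i j, ContDiff ℝ n fun θ => N θ i j) (i : l) (j : k) :
    ContDiff ℝ n fun θ => (M θ * N θ) i j := by
  simp only [Matrix.mul_apply]
  exact ContDiff.sum fun a _ => (hM i a).mul (hN a j)

theorem contDiff_causalAttention {n : WithTop ℕ∞} {T d e : ℕ} {Q K W : E → Matrix (Fin d) (Fin e) ℝ}
    {X : E → Matrix (Fin T) (Fin d) ℝ} (hQ : ∀ i j, ContDiff ℝ n fun θ => Q θ i j)
    (hK : ∀ i j, ContDiff ℝ n fun θ => K θ i j) (hW : ∀ i j, ContDiff ℝ n fun θ => W θ i j)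
    (hX : ∀ i j, ContDiff ℝ n fun θ => X θ i j) (t : Fin T) (j : Fin e) :
    ContDiff ℝ n fun θ => causalAttention (Q θ) (K θ) (W θ) (X θ) t j := by
  have hS : ∀ a b : Fin T, ContDiff ℝ n fun θ => if b ≤ a then
      Real.exp (((X θ * Q θ) * (X θ * K θ).transpose) a b / Real.sqrt e) else 0 := by
    intro a b
    split_ifs
    · exact ((contDiff_matrix_mul (contDiff_matrix_mul hX hQ)
        (N := fun θ => (X θ * K θ).transpose)
        (fun i j => contDiff_matrix_mul hX hK j i) a b).div_const _).exp
    · exact contDiff_const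
  have hpos : ∀ (θ : E) (a : Fin T), 0 < ∑ b : Fin T, if b ≤ a then
      Real.exp (((X θ * Q θ) * (X θ * K θ).transpose) a b / Real.sqrt e) else 0 := by
    intro θ a
    refine Finset.sum_pos' (fun b _ => ?_) ⟨a, Finset.mem_univ _, ?_⟩
    · split_ifs
      · positivity
      · exact le_rfl
    -- The diagonal entry is never masked, so the normalizing sum is positive.
    · rw [if_pos le_rfl]
      positivity
  exact contDiff_matrix_mul
    (M := fun θ => Matrix.of fun a b => (if b ≤ a then
      Real.exp (((X θ * Q θ) * (X θ * K θ).transpose) a b / Real.sqrt e) else 0) /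
      ∑ c : Fin T, if c ≤ a then
        Real.exp (((X θ * Q θ) * (X θ * K θ).transpose) a c / Real.sqrt e) else 0)
    (fun a b => (hS a b).div (ContDiff.sum fun c _ => hS a c) fun θ => (hpos θ a).ne')
    (contDiff_matrix_mul hX hW) t j

theorem contDiff_transformerBlock {n : WithTop ℕ∞} {σ : ℝ → ℝ} (hσ : ContDiff ℝ n σ) {ε : ℝ}
    (hε : 0 < ε) {T d H e : ℕ} {ws : List ℕ} {p : E → BlockParam d H e ws → ℝ}
    {X : E → Matrix (Fin T) (Fin d) ℝ} (hp : ∀ k, ContDiff ℝ n fun θ => p θ k)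
    (hX : ∀ t i, ContDiff ℝ n fun θ => X θ t i) (t : Fin T) (i : Fin d) :
    ContDiff ℝ n fun θ => transformerBlock σ ε (p θ) (X θ) t i := by
  have hY : ∀ t i, ContDiff ℝ n fun θ => (X θ + multiHead (p θ) (Matrix.of fun t =>
      layerNorm ε (fun i => p θ (.attnScale i)) (fun i => p θ (.attnShift i)) (X θ t))) t i := by
    intro t i
    refine (hX t i).add (contDiff_matrix_mul (fun t hj => ?_) (fun hj i => hp _) t i)
    exact contDiff_causalAttention (fun _ _ => hp _) (fun _ _ => hp _) (fun _ _ => hp _)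
      (fun t i => contDiff_layerNorm hε (fun _ => hp _) (fun _ => hp _) (hX t) i) t hj.2
  exact (hY t i).add (contDiff_mlpMap hσ ws (fun _ => hp _)
    (contDiff_layerNorm hε (fun _ => hp _) (fun _ => hp _) (hY t)) i)

variable {V : Type*} [Fintype V] {A : Arch} {n : WithTop ℕ∞}

theorem contDiff_hiddenStates (hσ : ContDiff ℝ n A.act) (hε : 0 < A.lnEps) (s : List V) (l : ℕ)
    (hl : l ≤ A.depth) (t : Fin s.length) (i : Fin A.dim) :
    ContDiff ℝ n fun θ : Params V A => hiddenStates θ s l hl t i := by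
  induction l generalizing t i with
  | zero =>
    refine ContDiff.add (contDiff_piLp_apply 2) ?_
    split_ifs
    · exact contDiff_piLp_apply 2
    · exact contDiff_const
  | succ l ih =>
    exact contDiff_transformerBlock hσ hε (fun k => contDiff_piLp_apply 2)
      (fun t i => ih (Nat.le_of_succ_le hl) t i) t i

theorem contDiff_softmaxFn [Nonempty V] {z : E → V → ℝ} (hz : ∀ v, ContDiff ℝ n fun θ => z θ v)
    (v : V) : ContDiff ℝ n fun θ => softmaxFn (z θ) v :=
  (hz v).exp.div (ContDiff.sum fun w _ => (hz w).exp)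
    fun _ => (Finset.sum_pos (fun _ _ => Real.exp_pos _) Finset.univ_nonempty).ne'

theorem softmaxFn_pos [Nonempty V] (z : V → ℝ) (v : V) : 0 < softmaxFn z v :=
  div_pos (Real.exp_pos _) (Finset.sum_pos (fun _ _ => Real.exp_pos _) Finset.univ_nonempty)

theorem contDiff_sampleLoss (hσ : ContDiff ℝ n A.act) (hε : 0 < A.lnEps)
    (x : Prompt V A.ctx × stdSimplex ℝ V) :
    ContDiff ℝ n fun θ : Params V A => sampleLoss x θ := by
  have := Prompt.nonempty x.1
  refine (ContDiff.sum fun v _ => contDiff_const.mul (ContDiff.log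
    (contDiff_softmaxFn (fun v => ContDiff.sum fun i _ => (contDiff_piLp_apply 2).mul ?_) v)
    fun θ => (softmaxFn_pos _ v).ne')).neg
  exact contDiff_layerNorm hε (fun _ => contDiff_piLp_apply 2) (fun _ => contDiff_piLp_apply 2)
    (contDiff_hiddenStates hσ hε _ _ _ _) i

theorem contDiff_batchLoss (hσ : ContDiff ℝ n A.act) (hε : 0 < A.lnEps) {m : ℕ}
    (data : Fin m → Prompt V A.ctx × stdSimplex ℝ V) (B : Multiset (Fin m)) :
    ContDiff ℝ n fun θ : Params V A => batchLoss data B θ := by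
  refine ContDiff.div_const ?_ _
  induction B using Multiset.induction with
  | empty => simpa using contDiff_const
  | cons a B ih => simpa using (contDiff_sampleLoss hσ hε (data a)).add ih

end ModelAnalytic

/-! ### Blocks with zero parameters are the identity, by the residual connections. -/

section ZeroBlocks

theorem mlpMap_zero (σ : ℝ → ℝ) {a : ℕ} (ws : List ℕ) {b : ℕ} (x : Fin a → ℝ) :
    mlpMap σ a ws b (fun _ => 0) x = 0 := by
  induction ws generalizing a with
  | nil =>
    funext i
    simp [mlpMap]
  | cons w ws ih => exact ih _

theorem transformerBlock_zero (σ : ℝ → ℝ) (ε : ℝ) {T d H e : ℕ} {ws : List ℕ}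
    (X : Matrix (Fin T) (Fin d) ℝ) :
    transformerBlock (H := H) (e := e) (ws := ws) σ ε (fun _ => 0) X = X := by
  have h : ∀ Z : Matrix (Fin T) (Fin d) ℝ,
      multiHead (H := H) (e := e) (ws := ws) (fun _ => 0) Z = 0 := by
    intro Z
    ext t i
    simp [multiHead, Matrix.mul_apply]
  ext t i
  simp [transformerBlock, h, mlpMap_zero]

theorem hiddenStates_of_block_zero {V : Type*} {A : Arch} {θ : Params V A}
    (h : ∀ l k, θ (.block l k) = 0) (s : List V) (l : ℕ) (hl : l ≤ A.depth) :
    hiddenStates θ s l hl = embedding θ s := by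
  induction l with
  | zero => rfl
  | succ l ih =>
    simp only [hiddenStates, h, transformerBlock_zero, ih]

theorem lastRepr_zero {V : Type*} {A : Arch} (s : Prompt V A.ctx) : lastRepr (0 : Params V A) s = 0 := by
  ext i
  simp [lastRepr, hiddenState, hiddenStates_of_block_zero (θ := (0 : Params V A)) (by simp),
    embedding]

end ZeroBlocks

/-! ### Invertibility of the Jacobian of a gradient step at the origin. -/

section GradientStep

open Filter Topology Gradient

/-- Existence of the limit forces `h'(0) = 0`; l'Hôpital's rule then identifies it with `h''(0) /
2`. -/
theorem ContDiff.deriv_deriv_zero_of_tendsto {h : ℝ → ℝ} (hh : ContDiff ℝ 2 h) {c : ℝ}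
    (hc : Tendsto (fun t => (h t - h 0) / t ^ 2) (𝓝[≠] 0) (𝓝 c)) : deriv (deriv h) 0 = 2 * c := by
  have hd : ContDiff ℝ 1 (deriv h) := (contDiff_succ_iff_deriv.1 hh).2.2
  have hh' : ∀ t, HasDerivAt h (deriv h t) t :=
    fun t => (hh.differentiable (by simp)).differentiableAt.hasDerivAt
  have hslope : Tendsto (fun t => (h t - h 0) / t) (𝓝[≠] 0) (𝓝 (deriv h 0)) := by
    have := hasDerivAt_iff_tendsto_slope.1 (hh' 0)
    refine this.congr fun t => ?_
    simp [slope_def_field]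
  have h0 : deriv h 0 = 0 := by
    refine tendsto_nhds_unique hslope ?_
    have hid : Tendsto (fun t : ℝ => t) (𝓝[≠] 0) (𝓝 0) := tendsto_nhdsWithin_of_tendsto_nhds tendsto_id
    have := hid.mul hc
    rw [zero_mul] at this
    refine this.congr' ?_
    filter_upwards [self_mem_nhdsWithin] with t ht
    have : t ≠ 0 := ht
    field_simp
  have hdd : Tendsto (fun t => deriv h t / (2 * t)) (𝓝[≠] 0) (𝓝 (deriv (deriv h) 0 / 2)) := by
    have := hasDerivAt_iff_tendsto_slope.1 ((hd.differentiable (by simp)) 0).hasDerivAt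
    refine (this.div_const 2).congr fun t => ?_
    simp [slope_def_field, h0, div_div, mul_comm]
  have hlim : Tendsto (fun t => (h t - h 0) / t ^ 2) (𝓝[≠] 0) (𝓝 (deriv (deriv h) 0 / 2)) := by
    refine HasDerivAt.lhopital_zero_nhdsNE (f' := deriv h) (g' := fun t => 2 * t)
      (Eventually.of_forall fun t => (hh' t).sub_const _)
      (Eventually.of_forall fun t => by simpa using hasDerivAt_pow 2 t) ?_ ?_ ?_ hdd
    · filter_upwards [self_mem_nhdsWithin] with t ht
      have : t ≠ 0 := ht
      simpa using this
    · refine tendsto_nhdsWithin_of_tendsto_nhds ?_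
      exact (hh.continuous.sub (continuous_const (y := h 0))).tendsto' 0 0 (by simp)
    · exact tendsto_nhdsWithin_of_tendsto_nhds ((continuous_pow 2).tendsto' 0 0 (by simp))
  linarith [tendsto_nhds_unique hc hlim]

variable {E : Type*} [NormedAddCommGroup E] [InnerProductSpace ℝ E] [FiniteDimensional ℝ E]
  {L : E → ℝ}

theorem ContDiff.gradient {n m : WithTop ℕ∞} (hL : ContDiff ℝ n L) (hmn : m + 1 ≤ n) :
    ContDiff ℝ m (∇ L) :=
  (InnerProductSpace.toDual ℝ E).symm.contDiff.comp (hL.fderiv_right hmn)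

/-- Reduces the Hessian form to expansions along rays, so no second partial derivatives of the model
are needed. -/
theorem inner_fderiv_gradient_self (hL : ContDiff ℝ 2 L) (ξ : E) :
    inner ℝ (fderiv ℝ (∇ L) 0 ξ) ξ = deriv (deriv fun t : ℝ => L (t • ξ)) 0 := by
  have hline : ∀ t : ℝ, HasDerivAt (fun t : ℝ => t • ξ) ξ t := fun t => by
    simpa using (hasDerivAt_id t).smul_const ξ
  have h1 : (deriv fun t : ℝ => L (t • ξ)) = fun t => inner ℝ (∇ L (t • ξ)) ξ := by
    funext t
    have hfd := ((hL.differentiable (by simp)) (t • ξ)).hasFDerivAt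
    refine (hfd.comp_hasDerivAt t (hline t)).deriv.trans ?_
    rw [← InnerProductSpace.toDual_apply_apply,
      toDual_gradient]
  have hg := ((hL.gradient (m := 1) (by norm_num)).differentiable (by simp)) ((0 : ℝ) • ξ)
  have h2 := (hg.hasFDerivAt.comp_hasDerivAt (0 : ℝ) (hline 0)).inner ℝ
    (hasDerivAt_const (0 : ℝ) ξ)
  rw [h1]
  have h3 := h2.deriv
  simp only [Function.comp_apply, inner_zero_right, zero_add, zero_smul] at h3
  exact h3.symm

/-- If the Hessian quadratic form of `L` at `0` is bounded above by `‖ξ‖²`, the Jacobian of a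
gradient step of size less than `1` is invertible at `0`. -/
theorem det_fderiv_gradientStep_ne_zero (hL : ContDiff ℝ 2 L) {η : ℝ} (hη0 : 0 < η) (hη1 : η < 1)
    (h : ∀ ξ : E, ∃ c ≤ ‖ξ‖ ^ 2 / 2,
      Tendsto (fun t : ℝ => (L (t • ξ) - L 0) / t ^ 2) (𝓝[≠] 0) (𝓝 c)) :
    (fderiv ℝ (fun θ => θ - η • ∇ L θ) 0).det ≠ 0 := by
  intro hdet
  obtain ⟨ξ, hξ, hξ0⟩ := (Submodule.ne_bot_iff _).1
    (LinearMap.bot_lt_ker_of_det_eq_zero (f := (fderiv ℝ (fun θ => θ - η • ∇ L θ) 0 : E →ₗ[ℝ] E))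
      hdet).ne'
  have hg := ((hL.gradient (m := 1) (by norm_num)).differentiable (by simp)) (0 : E)
  have hfd : fderiv ℝ (fun θ => θ - η • ∇ L θ) 0 = ContinuousLinearMap.id ℝ E -
      η • fderiv ℝ (∇ L) 0 :=
    ((hasFDerivAt_id (0 : E)).sub (hg.hasFDerivAt.const_smul η)).fderiv
  have hker : ξ - η • fderiv ℝ (∇ L) 0 ξ = 0 := by
    have : fderiv ℝ (fun θ => θ - η • ∇ L θ) 0 ξ = 0 := hξ
    rw [hfd] at this
    simpa using this
  -- A kernel vector satisfies `ξ = η • Hξ`. With `⟪Hξ, ξ⟫ = 2c ≤ ‖ξ‖²` this yields `‖ξ‖² ≤ η‖ξ‖² <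
  -- ‖ξ‖²`.
  have hnorm : ‖ξ‖ ^ 2 = η * inner ℝ (fderiv ℝ (∇ L) 0 ξ) ξ := by
    rw [← real_inner_self_eq_norm_sq, ← real_inner_smul_left, ← sub_eq_zero.1 hker]
  obtain ⟨c, hc, hlim⟩ := h ξ
  have hcd : ContDiff ℝ 2 fun t : ℝ => L (t • ξ) := hL.comp (contDiff_id.smul contDiff_const)
  rw [inner_fderiv_gradient_self hL, hcd.deriv_deriv_zero_of_tendsto (by simpa using hlim)]
    at hnorm
  have hpos : 0 < ‖ξ‖ ^ 2 := by positivity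
  nlinarith

end GradientStep

/-! ### Second-order expansion of the loss at the origin. -/

section LossExpansion

open Filter Topology

variable {V : Type*} [Fintype V]

theorem neg_sum_mul_log_softmaxFn [Nonempty V] {y : V → ℝ} (hy : y ∈ stdSimplex ℝ V) (z : V → ℝ) :
    -∑ v, y v * Real.log (softmaxFn z v) =
      Real.log (∑ w, Real.exp (z w)) - ∑ v, y v * z v := by
  have hS : 0 < ∑ w, Real.exp (z w) :=
    Finset.sum_pos (fun _ _ => Real.exp_pos _) Finset.univ_nonempty
  have h : ∀ v, Real.log (softmaxFn z v) = z v - Real.log (∑ w, Real.exp (z w)) := fun v => by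
    rw [softmaxFn, Real.log_div (Real.exp_pos _).ne' hS.ne', Real.log_exp]
  simp only [h, mul_sub, Finset.sum_sub_distrib, ← Finset.sum_mul, hy.2, one_mul, neg_sub]

/-- At zero logits the softmax is uniform, so the gradient is the uniform distribution minus the
target. -/
theorem hasFDerivAt_crossEntropy_zero [Nonempty V] (y : V → ℝ) :
    ∃ f' : (V → ℝ) →L[ℝ] ℝ,
      HasFDerivAt (fun z : V → ℝ => Real.log (∑ w, Real.exp (z w)) - ∑ v, y v * z v) f' 0 ∧
      ∀ w, f' w = ∑ v, ((Fintype.card V : ℝ)⁻¹ - y v) * w v := by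
  have hS : (∑ w : V, Real.exp ((0 : V → ℝ) w)) ≠ 0 := by simp
  have h1 := (HasFDerivAt.fun_sum (u := Finset.univ) fun (w : V) _ =>
    (hasFDerivAt_apply (𝕜 := ℝ) w (0 : V → ℝ)).exp).log hS
  have h2 := HasFDerivAt.fun_sum (u := Finset.univ) fun (v : V) _ =>
    (hasFDerivAt_apply (𝕜 := ℝ) v (0 : V → ℝ)).const_mul (y v)
  refine ⟨_, h1.sub h2, fun w => ?_⟩
  simp [sub_mul, Finset.sum_sub_distrib, Finset.mul_sum]

theorem sum_sq_uniform_sub_le_one [Nonempty V] {y : V → ℝ} (hy : y ∈ stdSimplex ℝ V) :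
    ∑ v, ((Fintype.card V : ℝ)⁻¹ - y v) ^ 2 ≤ 1 := by
  have hn : (Fintype.card V : ℝ) ≠ 0 := by simp
  have hsq : ∑ v, y v ^ 2 ≤ 1 := by
    rw [← hy.2]
    refine Finset.sum_le_sum fun v _ => ?_
    have h0 := hy.1 v
    have h1 : y v ≤ 1 := by
      rw [← hy.2]
      exact Finset.single_le_sum (fun w _ => hy.1 w) (Finset.mem_univ v)
    nlinarith
  have : ∑ v, ((Fintype.card V : ℝ)⁻¹ - y v) ^ 2 =
      ∑ v, y v ^ 2 - (Fintype.card V : ℝ)⁻¹ := by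
    simp only [sub_sq, Finset.sum_sub_distrib, Finset.sum_add_distrib, ← Finset.mul_sum, hy.2,
      Finset.sum_const, Finset.card_univ, nsmul_eq_mul]
    field_simp
    ring
  rw [this]
  have : (0 : ℝ) ≤ (Fintype.card V : ℝ)⁻¹ := by positivity
  linarith

/-- Cauchy–Schwarz over `v`, then `2ab ≤ a² + b²` in each coordinate `i`. This supplies the constant
`1/2` in the bound on the quadratic coefficient. -/
theorem sum_mul_sum_mul_le {ι : Type*} [Fintype ι] {g : V → ℝ} (hg : ∑ v, g v ^ 2 ≤ 1)
    (U : V → ι → ℝ) (β : ι → ℝ) :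
    ∑ v, g v * ∑ i, U v i * β i ≤ (∑ v, ∑ i, U v i ^ 2 + ∑ i, β i ^ 2) / 2 := by
  have h1 : ∑ v, g v * ∑ i, U v i * β i = ∑ i, (∑ v, g v * U v i) * β i := by
    simp only [Finset.mul_sum, Finset.sum_mul]
    rw [Finset.sum_comm]
    simp only [mul_assoc]
  have h2 : ∀ i, (∑ v, g v * U v i) ^ 2 ≤ ∑ v, U v i ^ 2 := fun i =>
    (Finset.sum_mul_sq_le_sq_mul_sq _ _ _).trans
      (mul_le_of_le_one_left (Finset.sum_nonneg fun _ _ => sq_nonneg _) hg)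
  rw [h1, Finset.sum_comm, ← Finset.sum_add_distrib, Finset.sum_div]
  refine Finset.sum_le_sum fun i _ => ?_
  nlinarith [h2 i, sq_nonneg ((∑ v, g v * U v i) - β i)]

variable {A : Arch}

theorem sum_unemb_add_sum_finalShift_le (ξ : Params V A) :
    ∑ v, ∑ i, ξ (.unemb v i) ^ 2 + ∑ i, ξ (.finalShift i) ^ 2 ≤ ‖ξ‖ ^ 2 := by
  classical
  let f : (V × Fin A.dim) ⊕ Fin A.dim → ParamIdx V A :=
    Sum.elim (fun p => .unemb p.1 p.2) .finalShift
  have hf : Function.Injective f := by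
    rintro (⟨v, i⟩ | i) (⟨v', i'⟩ | i') h <;> simp [f] at h ⊢ <;> exact h
  have hle := Finset.sum_le_univ_sum_of_nonneg (s := Finset.univ.map ⟨f, hf⟩)
    (f := fun k => ξ k ^ 2) fun _ => sq_nonneg _
  rw [Finset.sum_map, Fintype.sum_sum_type, Fintype.sum_prod_type] at hle
  simpa [EuclideanSpace.norm_sq_eq, f] using hle

/-- Along a ray from the origin of parameter space, the loss of a sample is, to second order, its
value at `0` plus `t²` times a coefficient bounded by half the squared norm of the direction: the
logits are themselves `O(t²)`, as the unembedding and the final normalization both vanish at `0`. -/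
theorem exists_tendsto_sampleLoss_smul (hact : Continuous A.act)
    (hε : 0 < A.lnEps) (x : Prompt V A.ctx × stdSimplex ℝ V) (ξ : Params V A) :
    ∃ c ≤ ‖ξ‖ ^ 2 / 2, Tendsto
      (fun t : ℝ => (sampleLoss x (t • ξ) - sampleLoss x 0) / t ^ 2) (𝓝[≠] 0) (𝓝 c) := by
  have := Prompt.nonempty x.1
  -- The logits at `t • ξ` divided by `t²`: one factor `t` comes from the unembedding, one from the
  -- final scale and shift. Only the last-token representation still depends on `t`.
  let w : ℝ → V → ℝ := fun t v => ∑ i, ξ (.unemb v i) * layerNorm A.lnEps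
    (fun i => ξ (.finalScale i)) (fun i => ξ (.finalShift i)) (lastRepr (t • ξ) x.1) i
  have hw : Continuous w := by
    refine continuous_pi fun v => continuous_finsetSum _ fun i _ => continuous_const.mul ?_
    have h1 : ContDiff ℝ 0 fun θ : Params V A => layerNorm A.lnEps
        (fun i => ξ (.finalScale i)) (fun i => ξ (.finalShift i)) (lastRepr θ x.1) i :=
      contDiff_layerNorm hε (fun _ => contDiff_const) (fun _ => contDiff_const)
        (contDiff_hiddenStates (contDiff_zero.2 hact) hε _ _ _ _) i
    exact h1.continuous.comp (continuous_id.smul continuous_const)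
  -- The representation at the origin is `0`, so its normalization leaves only the shift.
  have hw0 : w 0 = fun v => ∑ i, ξ (.unemb v i) * ξ (.finalShift i) := by
    funext v
    simp [w, lastRepr_zero, layerNorm]
  have hloss : ∀ t : ℝ, sampleLoss x (t • ξ) =
      Real.log (∑ v, Real.exp ((t ^ 2 • w t) v)) - ∑ v, (x.2 : V → ℝ) v * (t ^ 2 • w t) v := by
    intro t
    rw [sampleLoss, ← neg_sum_mul_log_softmaxFn (y := (x.2 : V → ℝ)) x.2.2]
    unfold nextToken
    congr! 6 with v _ v
    simp only [Pi.smul_apply, w, smul_eq_mul, Finset.mul_sum, layerNorm, PiLp.smul_apply]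
    refine Finset.sum_congr rfl fun i _ => ?_
    ring
  obtain ⟨f', hf', hf'w⟩ := hasFDerivAt_crossEntropy_zero (x.2 : V → ℝ)
  refine ⟨f' (w 0), ?_, ?_⟩
  · rw [hf'w, hw0]
    have h1 := sum_mul_sum_mul_le (sum_sq_uniform_sub_le_one (y := (x.2 : V → ℝ)) x.2.2)
      (fun v i => ξ (.unemb v i)) (fun i => ξ (.finalShift i))
    have h2 := sum_unemb_add_sum_finalShift_le ξ
    linarith
  · have hcont : Continuous fun t : ℝ => t ^ 2 • w t := (continuous_pow 2).smul hw
    have hlim := (hasFDerivWithinAt_univ.2 hf').lim (l := 𝓝[≠] (0 : ℝ))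
      (c := fun t => (t ^ 2)⁻¹) (d := fun t => t ^ 2 • w t) (v := w 0)
      (tendsto_nhdsWithin_of_tendsto_nhds (hcont.tendsto' 0 0 (by simp)))
      (Eventually.of_forall fun _ => Set.mem_univ _) ?_
    · refine hlim.congr fun t => ?_
      have h0 := hloss 0
      rw [zero_smul] at h0
      rw [hloss t, h0]
      simp only [zero_add, smul_eq_mul, ne_eq, OfNat.ofNat_ne_zero, not_false_eq_true, zero_pow,
        zero_smul]
      rw [div_eq_inv_mul]
    · refine (tendsto_nhdsWithin_of_tendsto_nhds (hw.tendsto 0)).congr' ?_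
      filter_upwards [self_mem_nhdsWithin] with t ht
      have ht' : t ≠ 0 := ht
      rw [smul_smul, inv_mul_cancel₀ (pow_ne_zero 2 ht'), one_smul]

theorem exists_tendsto_batchLoss_smul (hact : Continuous A.act) (hε : 0 < A.lnEps) {n : ℕ}
    (data : Fin n → Prompt V A.ctx × stdSimplex ℝ V) (B : Multiset (Fin n)) (ξ : Params V A) :
    ∃ c ≤ ‖ξ‖ ^ 2 / 2, Tendsto
      (fun t : ℝ => (batchLoss data B (t • ξ) - batchLoss data B 0) / t ^ 2) (𝓝[≠] 0) (𝓝 c) := by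
  have hsum : ∃ c ≤ (Multiset.card B : ℝ) * (‖ξ‖ ^ 2 / 2), Tendsto
      (fun t : ℝ => ((B.map fun i => sampleLoss (data i) (t • ξ)).sum -
        (B.map fun i => sampleLoss (data i) 0).sum) / t ^ 2) (𝓝[≠] 0) (𝓝 c) := by
    induction B using Multiset.induction with
    | empty => exact ⟨0, by simp, by simp⟩
    | cons a B ih =>
      obtain ⟨c, hc, hlim⟩ := ih
      obtain ⟨c', hc', hlim'⟩ := exists_tendsto_sampleLoss_smul hact hε (data a) ξ
      refine ⟨c' + c, ?_, (hlim'.add hlim).congr fun t => ?_⟩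
      · push_cast [Multiset.card_cons]
        linarith
      · simp only [Multiset.map_cons, Multiset.sum_cons]
        ring
  obtain ⟨c, hc, hlim⟩ := hsum
  -- An empty batch is covered too: division by zero gives `0`.
  refine ⟨c / Multiset.card B, div_le_of_le_mul₀ (by positivity) (by positivity) ?_,
    (hlim.div_const _).congr fun t => ?_⟩
  · linarith
  · simp only [batchLoss]
    ring

end LossExpansion

/-! ### Almost sure injectivity of the one-step maps after training. -/

section AlmostSure

open MeasureTheory

variable {V : Type*} [Fintype V] {A : Arch}

theorem quasiMeasurePreserving_gradientStep (hact : ContDiff ℝ ω A.act) (hε : 0 < A.lnEps) {n : ℕ}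
    (data : Fin n → Prompt V A.ctx × stdSimplex ℝ V) (B : Multiset (Fin n)) {η : ℝ}
    (hη : 0 < η ∧ η < 1) :
    Measure.QuasiMeasurePreserving
      (fun θ : Params V A => θ - η • gradient (batchLoss data B) θ) volume volume := by
  have hL : ContDiff ℝ ω (batchLoss (A := A) data B) := contDiff_batchLoss hact hε data B
  refine ContDiff.quasiMeasurePreserving (a := 0)
    (contDiff_id.sub ((hL.gradient (m := ω) (by simp)).const_smul η)) ?_
  exact det_fderiv_gradientStep_ne_zero (hL.of_le (by simp)) hη.1 hη.2
    (exists_tendsto_batchLoss_smul hact.continuous hε data B)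

theorem quasiMeasurePreserving_trained (hact : ContDiff ℝ ω A.act) (hε : 0 < A.lnEps) {n : ℕ}
    (data : Fin n → Prompt V A.ctx × stdSimplex ℝ V) {η : ℕ → ℝ} (B : ℕ → Multiset (Fin n))
    {N : ℕ} (hη : ∀ k < N, 0 < η k ∧ η k < 1) :
    Measure.QuasiMeasurePreserving (fun θ₀ : Params V A => trained data η B θ₀ N)
      volume volume := by
  induction N with
  | zero => exact Measure.QuasiMeasurePreserving.id _
  | succ N ih =>
    exact (quasiMeasurePreserving_gradientStep hact hε data (B N) (hη N N.lt_succ_self)).comp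
      (ih fun k hk => hη k (hk.trans N.lt_succ_self))

theorem trained_congr {n : ℕ} (data : Fin n → Prompt V A.ctx × stdSimplex ℝ V) (η : ℕ → ℝ)
    {B B' : ℕ → Multiset (Fin n)} (θ₀ : Params V A) {N : ℕ} (h : ∀ k < N, B k = B' k) :
    trained data η B θ₀ N = trained data η B' θ₀ N := by
  induction N with
  | zero => rfl
  | succ N ih =>
    simp only [trained, ih fun k hk => h k (hk.trans N.lt_succ_self), h N N.lt_succ_self]

theorem ae_oneStep_ne (hact : ContDiff ℝ ω A.act) (hε : 0 < A.lnEps) (hd : 0 < A.dim) (l : ℕ)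
    (hl : l ≤ A.depth) (π : List V) {v v' : V} (hv : v ≠ v') :
    ∀ᵐ θ : Params V A, oneStep θ l hl π v ≠ oneStep θ l hl π v' := by
  classical
  let i₀ : Fin A.dim := ⟨0, hd⟩
  have hcd : ContDiff ℝ ω fun θ : Params V A => oneStep θ l hl π v i₀ - oneStep θ l hl π v' i₀ :=
    (contDiff_hiddenStates hact hε _ _ _ _ _).sub (contDiff_hiddenStates hact hε _ _ _ _ _)
  -- The witness has a single nonzero parameter, one embedding coordinate of `v`. The hidden state
  -- is the embedding, so coordinate `i₀` is `1` at `v` and `0` at `v'`.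
  have hne : oneStep (EuclideanSpace.single (ParamIdx.tok v i₀) 1 : Params V A) l hl π v i₀ -
      oneStep (EuclideanSpace.single (ParamIdx.tok v i₀) 1 : Params V A) l hl π v' i₀ ≠ 0 := by
    have hblock : ∀ l k, (EuclideanSpace.single (ParamIdx.tok v i₀) 1 : Params V A)
        (.block l k) = 0 := by simp
    simp [oneStep, hiddenState, hiddenStates_of_block_zero hblock, embedding, hv.symm]
  filter_upwards [hcd.ae_ne_zero volume hne] with θ hθ h
  simp [h] at hθ

theorem ae_forall_trained_oneStep_ne (hact : ContDiff ℝ ω A.act) (hε : 0 < A.lnEps)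
    (hd : 0 < A.dim) (l : ℕ) (hl : l ≤ A.depth) {n : ℕ}
    (data : Fin n → Prompt V A.ctx × stdSimplex ℝ V) {N : ℕ} {η : ℕ → ℝ}
    (hη : ∀ k < N, 0 < η k ∧ η k < 1) :
    ∀ᵐ θ₀ : Params V A, ∀ (B : ℕ → Multiset (Fin n)) (π : List V) (v v' : V), v ≠ v' →
      oneStep (trained data η B θ₀ N) l hl π v ≠ oneStep (trained data η B θ₀ N) l hl π v' := by
  have hgood : ∀ᵐ θ : Params V A, ∀ (π : List V) (v v' : V), v ≠ v' →
      oneStep θ l hl π v ≠ oneStep θ l hl π v' := by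
    simp only [ae_all_iff]
    exact fun π v v' hv => ae_oneStep_ne hact hε hd l hl π hv
  -- Infinite batch sequences are uncountable, but only the first `N` batches matter. Truncated
  -- sequences form a countable type, so the quantifier over batches moves inside and covers
  -- adversarial choices.
  have hfin : ∀ᵐ θ₀ : Params V A, ∀ B : Fin N → Multiset (Fin n), ∀ (π : List V) (v v' : V),
      v ≠ v' →
      oneStep (trained data η (fun k => if h : k < N then B ⟨k, h⟩ else 0) θ₀ N) l hl π v ≠
        oneStep (trained data η (fun k => if h : k < N then B ⟨k, h⟩ else 0) θ₀ N) l hl π v' :=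
    ae_all_iff.2 fun B => (quasiMeasurePreserving_trained hact hε data _ hη).ae hgood
  filter_upwards [hfin] with θ₀ h B
  rw [trained_congr data η θ₀ (B := B)
    (B' := fun k => if h : k < N then (fun k : Fin N => B k) ⟨k, h⟩ else 0)
    (fun k hk => by simp [hk])]
  exact h fun k => B k

end AlmostSure

theorem theorem3p1 {V : Type*} [Fintype V] (A : Arch)
    -- standing assumptions on the architecture
    (hdim : 4 ≤ A.dim) (hheads : ∀ b, 1 ≤ A.heads b) (hheadDim : ∀ b, 1 ≤ A.headDim b)
    (hact : AnalyticOnNhd ℝ A.act Set.univ) (hln : 0 < A.lnEps)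
    -- the observed layer
    (l : ℕ) (hl1 : 1 ≤ l) (hl : l ≤ A.depth) :
    -- termination and step bound, for arbitrary parameters and observations
    (∀ (θ : Params V A) (ε : ℝ) (P : Policy V) (T : ℕ) (_ : T ≤ A.ctx)
        (obs : Fin T → EuclideanSpace ℝ (Fin A.dim)),
      (∀ t, (sipItStep θ l hl ε P obs t).2 ≤ Fintype.card V) ∧
        sipItTests θ l hl ε P obs ≤ T * Fintype.card V) ∧
    -- almost sure correctness for randomly initialized, trained models
    (∀ (μ : MeasureTheory.Measure (Params V A)) [MeasureTheory.IsProbabilityMeasure μ]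
        (_ : μ.AbsolutelyContinuous MeasureTheory.volume)
        (n : ℕ) (data : Fin n → Prompt V A.ctx × stdSimplex ℝ V)
        (N : ℕ) (η : ℕ → ℝ) (_ : ∀ k < N, 0 < η k ∧ η k < 1),
      ∀ᵐ θ₀ ∂μ, ∀ B : ℕ → Multiset (Fin n), (∀ k < N, B k ≠ 0) →
        ∀ θ : Params V A, θ = trained data η B θ₀ N →
        ∀ s : Prompt V A.ctx,
          (∀ t : Fin s.1.length, 0 < margin θ l hl (s.1.take t)) ∧
          ∀ (ε : ℝ) (e : Fin s.1.length → EuclideanSpace ℝ (Fin A.dim)),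
            0 ≤ ε → (∀ t, ‖e t‖ ≤ ε) →
            (ε = 0 ∨ ∀ t : Fin s.1.length, ENNReal.ofReal ε < margin θ l hl (s.1.take t) / 2) →
            ∀ (P : Policy V) (obs : Fin s.1.length → EuclideanSpace ℝ (Fin A.dim)),
              (∀ t, obs t = hiddenState θ l hl s.1 t + e t) →
              (∀ t, (sipItStep θ l hl ε P obs t).1 = some (s.1.get t) ∧
                (sipItStep θ l hl ε P obs t).2 ≤ Fintype.card V) ∧
              sipItOutput θ l hl ε P obs = s.1 ∧
              sipItTests θ l hl ε P obs ≤ s.1.length * Fintype.card V) := by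
  have hω : ContDiff ℝ ω A.act := contDiff_omega_iff_analyticOnNhd.2 hact
  refine ⟨fun θ ε P T _ obs =>
    ⟨sipItStep_tests_le θ l hl ε P obs, sipItTests_le θ l hl ε P obs⟩, ?_⟩
  intro μ _ hμ n data N η hη
  filter_upwards [hμ.ae_le (ae_forall_trained_oneStep_ne hω hln (by omega) l hl data hη)]
    with θ₀ h B _ θ hθ s
  have hpos : ∀ t : Fin s.1.length, 0 < margin θ l hl (s.1.take t) :=
    fun t => margin_pos (by rw [hθ]; exact h B _)
  refine ⟨hpos, fun ε e hε he hεm P obs hobs => ?_⟩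
  have hacc : ∀ (t : Fin s.1.length) (v : V),
      obs t ∈ acceptRegion θ l hl ε (s.1.take t) v ↔ v = s.1.get t := fun t v => by
    rw [hobs, hiddenState_eq_oneStep]
    exact mem_acceptRegion_iff (hpos t) hε (he t) (hεm.imp_right fun h => h t) v
  have hcorrect := sipIt_correct (P := P) hacc
  exact ⟨fun t => ⟨hcorrect.1 t, sipItStep_tests_le θ l hl ε P obs t⟩, hcorrect.2,
    sipItTests_le θ l hl ε P obs⟩
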